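/- Let $\mathcal{C}$ be an abelian category with enough projectives. A cohomological functor from $\mathcal{C}$ to $\mathbf{Ab}$ is a family of additive functors $(T^n:\mathcal{C}\to\mathbf{Ab})_{n\in\mathbb{Z}}$ together with connecting homomorphisms $\delta^n:T^n(Z)\to T^{n+1}(X)$ for every short exact sequence $0\to X\to Y\to Z\to 0$, natural in the short exact sequence, such that the resulting long sequences are exact. A morphism of cohomological functors is a family of natural transformations $T^n\to U^n$ $(n\in\mathbb{Z})$ that commutes with the connecting homomorphisms. A Mislin completion of $T^\bullet$ is a cohomological functor $\widehat{T}^\bullet$ that vanishes on projectives (that is, $\widehat{T}^n(P)=0$ for all projective $P$ and all $n\in\mathbb{Z}$), together with a morphism $\nu^\bullet:T^\bullet\to\widehat{T}^\bullet$ such that every morphism from $T^\bullet$ to a cohomological functor vanishing on projectives factors uniquely through $\nu^\bullet$. For $A\in\mathrm{obj}(\mathcal{C})$, extend the (unenriched) Ext-functors to a cohomological functor $\mathrm{Ext}^\bullet_{\mathcal{C}}(A,-)$ by $\mathrm{Ext}^n_{\mathcal{C}}(A,-)=0$ for $n<0$; the completed unenriched Ext-functors $\widehat{\mathrm{Ext}}{}^\bullet_{\mathcal{C}}(A,-)$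 are its Mislin completion, which is unique up to isomorphism whenever it exists. A complete resolution of $A$ is an acyclic chain complex $(\overline{A}_n)_{n\in\mathbb{Z}}$ of projectives such that for some $n\ge 0$ the part $(\overline{A}_k)_{k\ge n}$ agrees (up to isomorphism compatible with the differentials) with that of a projective resolution of $A$, and such that $\mathrm{Hom}_{\mathcal{C}}(\overline{A}_\bullet,P)$ is acyclic for every projective $P$. Its Tate–Farrell Ext-functors are $\overline{\mathrm{Ext}}{}^n_{\mathcal{C}}(A,B):=H^n(\mathrm{Hom}_{\mathcal{C}}(\overline{A}_\bullet,B))$ for $n\in\mathbb{Z}$; they form a cohomological functor in $B$, with the connecting homomorphisms of the short exact sequences of cochain complexes $0\to\mathrm{Hom}_{\mathcal{C}}(\overline{A}_\bullet,X)\to\mathrm{Hom}_{\mathcal{C}}(\overline{A}_\bullet,Y)\to\mathrm{Hom}_{\mathcal{C}}(\overline{A}_\bullet,Z)\to 0$. **Lemma.** Let $\overline{A}_\bullet$ be a complete resolution of $A\in\mathrm{obj}(\mathcal{C})$. Then $\mathrm{Ext}^\bullet_{\mathcal{C}}(A,-)$ has a Mislin completion $\widehat{\mathrm{Ext}}{}^\bullet_{\mathcal{C}}(A,-)$,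 and for every such Mislin completion $\overline{\mathrm{Ext}}{}^\bullet_{\mathcal{C}}(A,-)$ and $\widehat{\mathrm{Ext}}{}^\bullet_{\mathcal{C}}(A,-)$ are isomorphic as cohomological functors. -/

import Mathlib

open CategoryTheory CategoryTheory.Limits

universe v u v' u'

noncomputable section

/-! ### Cohomological functors -/

/-- A cohomological functor from `C` to `D`: additive functors `T n`, `n : ℤ`, with connecting
homomorphisms `T n S.X₃ ⟶ T (n + 1) S.X₁` for every short exact sequence
`0 ⟶ S.X₁ ⟶ S.X₂ ⟶ S.X₃ ⟶ 0`, natural in the short exact sequence, such that the resulting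
long sequences are exact.  (The target degree of the connecting homomorphism is an index `n₁`
together with a proof of `n₀ + 1 = n₁`.) -/
structure CohomologicalFunctor (C : Type u) [Category.{v} C] [Abelian C]
    (D : Type u') [Category.{v'} D] [Abelian D] where
  /-- the functor in degree `n` -/
  T : ℤ → C ⥤ D
  additive : ∀ n, (T n).Additive
  /-- the connecting homomorphisms -/
  δ : ∀ {S : ShortComplex C} (_ : S.ShortExact) (n₀ n₁ : ℤ) (_ : n₀ + 1 = n₁),
    (T n₀).obj S.X₃ ⟶ (T n₁).obj S.X₁
  δ_naturality : ∀ {S S' : ShortComplex C} (hS : S.ShortExact) (hS' : S'.ShortExact) (φ : S ⟶ S')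
    (n₀ n₁ : ℤ) (h : n₀ + 1 = n₁),
    δ hS n₀ n₁ h ≫ (T n₁).map φ.τ₁ = (T n₀).map φ.τ₃ ≫ δ hS' n₀ n₁ h
  map_comp_map : ∀ {S : ShortComplex C} (_ : S.ShortExact) (n : ℤ),
    (T n).map S.f ≫ (T n).map S.g = 0
  map_comp_δ : ∀ {S : ShortComplex C} (hS : S.ShortExact) (n₀ n₁ : ℤ) (h : n₀ + 1 = n₁),
    (T n₀).map S.g ≫ δ hS n₀ n₁ h = 0
  δ_comp_map : ∀ {S : ShortComplex C} (hS : S.ShortExact) (n₀ n₁ : ℤ) (h : n₀ + 1 = n₁),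
    δ hS n₀ n₁ h ≫ (T n₁).map S.f = 0
  /-- exactness at `T n S.X₂` -/
  exact₂ : ∀ {S : ShortComplex C} (hS : S.ShortExact) (n : ℤ),
    (ShortComplex.mk _ _ (map_comp_map hS n)).Exact
  /-- exactness at `T n₀ S.X₃` -/
  exact₃ : ∀ {S : ShortComplex C} (hS : S.ShortExact) (n₀ n₁ : ℤ) (h : n₀ + 1 = n₁),
    (ShortComplex.mk _ _ (map_comp_δ hS n₀ n₁ h)).Exact
  /-- exactness at `T n₁ S.X₁` -/
  exact₁ : ∀ {S : ShortComplex C} (hS : S.ShortExact) (n₀ n₁ : ℤ) (h : n₀ + 1 = n₁),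
    (ShortComplex.mk _ _ (δ_comp_map hS n₀ n₁ h)).Exact

namespace CohomologicalFunctor

variable {C : Type u} [Category.{v} C] [Abelian C] {D : Type u'} [Category.{v'} D] [Abelian D]

/-- A morphism of cohomological functors: natural transformations in each degree which commute
with the connecting homomorphisms. -/
@[ext]
structure Hom (T U : CohomologicalFunctor C D) where
  /-- the natural transformation in degree `n` -/
  app : ∀ n : ℤ, T.T n ⟶ U.T n
  comm : ∀ {S : ShortComplex C} (hS : S.ShortExact) (n₀ n₁ : ℤ) (h : n₀ + 1 = n₁),
    T.δ hS n₀ n₁ h ≫ (app n₁).app S.X₁ = (app n₀).app S.X₃ ≫ U.δ hS n₀ n₁ h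

/-- Cohomological functors from `C` to `D` form a category; composition is degreewise. -/
instance : Category (CohomologicalFunctor C D) where
  Hom := Hom
  id T :=
    { app := fun n => 𝟙 (T.T n)
      comm := fun hS n₀ n₁ h => by simp }
  comp {T U V} f g :=
    { app := fun n => f.app n ≫ g.app n
      comm := fun hS n₀ n₁ h => by
        rw [NatTrans.comp_app, NatTrans.comp_app, ← Category.assoc, f.comm, Category.assoc,
          g.comm, Category.assoc] }
  id_comp f := Hom.ext (funext fun n => Category.id_comp (f.app n))
  comp_id f := Hom.ext (funext fun n => Category.comp_id (f.app n))
  assoc f g h := Hom.ext (funext fun n => Category.assoc (f.app n) (g.app n) (h.app n))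

/-- A cohomological functor vanishes on projectives if all its terms do. -/
def VanishesOnProjectives (T : CohomologicalFunctor C D) : Prop :=
  ∀ (P : C), Projective P → ∀ n : ℤ, IsZero ((T.T n).obj P)

/-- `ν : T ⟶ T'` exhibits `T'` as the Mislin completion of `T`: `T'` vanishes on projectives, and
every morphism from `T` to a cohomological functor vanishing on projectives factors uniquely
through `ν`. -/
structure IsMislinCompletion {T T' : CohomologicalFunctor C D} (ν : T ⟶ T') : Prop where
  vanishes : T'.VanishesOnProjectives
  existsUnique_factor : ∀ (U : CohomologicalFunctor C D), U.VanishesOnProjectives →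
    ∀ f : T ⟶ U, ∃! g : T' ⟶ U, ν ≫ g = f

end CohomologicalFunctor

variable {C : Type u} [Category.{v} C] [Abelian C]

/-! ### The unenriched Ext-functors, extended by zero to negative degrees -/

instance hasExtOfEnoughProjectives [EnoughProjectives C] : HasExt.{v} C :=
  hasExt_of_enoughProjectives.{v} C

section Ext

open CategoryTheory.Abelian

variable [HasExt.{v} C] (A : C)

/-- `Ext^n(A, -)` for `n ≥ 0`, and the zero functor for `n < 0`. -/
def extT : ℤ → C ⥤ AddCommGrpCat.{v}
  | Int.ofNat n => extFunctorObj A n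
  | Int.negSucc _ => (Functor.const C).obj (AddCommGrpCat.of PUnit.{v + 1})

/-- The connecting homomorphisms of `Ext^•(A, -)`: in degrees `n ≥ 0`, the Yoneda product with the
class in `Ext^1(S.X₃, S.X₁)` of the short exact sequence. -/
def extδ {S : ShortComplex C} (hS : S.ShortExact) :
    ∀ (n₀ n₁ : ℤ) (_ : n₀ + 1 = n₁), (extT A n₀).obj S.X₃ ⟶ (extT A n₁).obj S.X₁
  | Int.ofNat a, Int.ofNat b, h =>
      AddCommGrpCat.ofHom (hS.extClass.postcomp A (show a + 1 = b from Int.ofNat.inj h))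
  | Int.ofNat _, Int.negSucc _, _ => 0
  | Int.negSucc _, _, _ => 0

theorem isZero_extT_negSucc (n : ℕ) (B : C) : IsZero ((extT A (Int.negSucc n)).obj B) :=
  AddCommGrpCat.isZero_of_subsingleton (AddCommGrpCat.of PUnit.{v + 1})

/-- The Ext-functors `Ext^•(A, -)` as a cohomological functor. -/
def extCohomologicalFunctor : CohomologicalFunctor C AddCommGrpCat.{v} where
  T := extT A
  additive n := by
    rcases n with n | n
    · exact inferInstanceAs (extFunctorObj A n).Additive
    · exact ⟨fun {X Y f g} => (isZero_extT_negSucc A n _).eq_of_src _ _⟩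
  δ hS := extδ A hS
  δ_naturality {S S'} hS hS' φ n₀ n₁ h := by
    rcases n₀ with a | a
    · rcases n₁ with b | b
      · ext x
        have h' : a + 1 = b := Int.ofNat.inj h
        have key (y : Ext A S.X₃ a) :
            (y.comp hS.extClass h').comp (Ext.mk₀ φ.τ₁) (add_zero b) =
              (y.comp (Ext.mk₀ φ.τ₃) (add_zero a)).comp hS'.extClass h' := by
          rw [Ext.comp_assoc_of_third_deg_zero, Ext.comp_assoc_of_second_deg_zero,
            ShortComplex.ShortExact.extClass_naturality hS hS' φ]
        exact key x
      · exact (isZero_extT_negSucc A b _).eq_of_tgt _ _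
    · exact (isZero_extT_negSucc A a _).eq_of_src _ _
  map_comp_map {S} hS n := by
    rcases n with n | n
    · rw [← Functor.map_comp, S.zero]
      exact (extFunctorObj A n).map_zero _ _
    · exact (isZero_extT_negSucc A n _).eq_of_src _ _
  map_comp_δ {S} hS n₀ n₁ h := by
    rcases n₀ with a | a
    · rcases n₁ with b | b
      · ext x
        have h' : a + 1 = b := Int.ofNat.inj h
        have key (y : Ext A S.X₂ a) :
            (y.comp (Ext.mk₀ S.g) (add_zero a)).comp hS.extClass h' = 0 := by
          rw [Ext.comp_assoc_of_second_deg_zero, hS.comp_extClass, Ext.comp_zero]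
        exact key x
      · exact (isZero_extT_negSucc A b _).eq_of_tgt _ _
    · exact (isZero_extT_negSucc A a _).eq_of_src _ _
  δ_comp_map {S} hS n₀ n₁ h := by
    rcases n₀ with a | a
    · rcases n₁ with b | b
      · ext x
        have h' : a + 1 = b := Int.ofNat.inj h
        have key (y : Ext A S.X₃ a) :
            (y.comp hS.extClass h').comp (Ext.mk₀ S.f) (add_zero b) = 0 := by
          rw [Ext.comp_assoc_of_third_deg_zero, hS.extClass_comp, Ext.comp_zero]
        exact key x
      · exact (isZero_extT_negSucc A b _).eq_of_tgt _ _
    · exact (isZero_extT_negSucc A a _).eq_of_src _ _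
  exact₂ {S} hS n := by
    rcases n with n | n
    · exact Ext.covariant_sequence_exact₂' A hS n
    · exact ShortComplex.exact_of_isZero_X₂ _ (isZero_extT_negSucc A n S.X₂)
  exact₃ {S} hS n₀ n₁ h := by
    rcases n₀ with a | a
    · rcases n₁ with b | b
      · exact Ext.covariant_sequence_exact₃' A hS a b (Int.ofNat.inj h)
      · exact absurd h (by simp only [Int.ofNat_eq_natCast, Int.negSucc_eq]; omega)
    · exact ShortComplex.exact_of_isZero_X₂ _ (isZero_extT_negSucc A a S.X₃)
  exact₁ {S} hS n₀ n₁ h := by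
    rcases n₁ with b | b
    · rcases n₀ with a | a
      · exact Ext.covariant_sequence_exact₁' A hS a b (Int.ofNat.inj h)
      · have hb : b = 0 := by simp only [Int.ofNat_eq_natCast, Int.negSucc_eq] at h; omega
        subst hb
        have := hS.mono_f
        have : Mono ((extT A (Int.ofNat 0)).map S.f) := Ext.mono_postcomp_mk₀_of_mono A S.f
        exact (ShortComplex.exact_iff_mono _
          ((isZero_extT_negSucc A a S.X₃).eq_of_src _ _)).2 this
    · exact ShortComplex.exact_of_isZero_X₂ _ (isZero_extT_negSucc A b S.X₁)

end Ext

/-! ### Cohomology of Hom from a complex of projectives -/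

/-- The cochain complex of abelian groups `Hom(K_•, B)`, with `Hom(K_n, B)` in degree `n`. -/
@[simps]
def homComplex (K : ChainComplex C ℤ) (B : C) : CochainComplex AddCommGrpCat.{v} ℤ where
  X n := AddCommGrpCat.of (K.X n ⟶ B)
  d i j := AddCommGrpCat.ofHom (Preadditive.leftComp B (K.d j i))
  shape i j h := by
    ext f
    change K.d j i ≫ f = 0
    rw [K.shape j i h, zero_comp]
  d_comp_d' i j k _ _ := by
    ext f
    change K.d k j ≫ K.d j i ≫ f = 0
    rw [← Category.assoc, K.d_comp_d, zero_comp]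

/-- The functor `B ↦ Hom(K_•, B)`. -/
@[simps]
def homComplexFunctor (K : ChainComplex C ℤ) : C ⥤ CochainComplex AddCommGrpCat.{v} ℤ where
  obj B := homComplex K B
  map {B B'} g :=
    { f := fun n => AddCommGrpCat.ofHom (Preadditive.rightComp (K.X n) g)
      comm' := fun i j _ => by
        ext f
        exact (Category.assoc (K.d j i) (f : K.X i ⟶ B) g).symm }
  map_id B := by
    ext n f
    exact Category.comp_id (f : K.X n ⟶ B)
  map_comp g g' := by
    ext n f
    exact (Category.assoc _ _ _).symm

instance (K : ChainComplex C ℤ) : (homComplexFunctor K).Additive where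
  map_add {B B' g g'} := by
    ext n f
    exact Preadditive.comp_add _ _ _ _ _ _

theorem homComplex_shortExact (K : ChainComplex C ℤ) (hK : ∀ n, Projective (K.X n))
    {S : ShortComplex C} (hS : S.ShortExact) : (S.map (homComplexFunctor K)).ShortExact := by
  refine HomologicalComplex.shortExact_of_degreewise_shortExact _ fun n => ?_
  have := hK n
  have := hS.mono_f
  have := hS.epi_g
  refine { exact := ?_, mono_f := ?_, epi_g := ?_ }
  · rw [ShortComplex.ab_exact_iff]
    intro (x : K.X n ⟶ S.X₂) (hx : x ≫ S.g = 0)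
    exact ⟨hS.exact.lift x hx, hS.exact.lift_f x hx⟩
  · rw [AddCommGrpCat.mono_iff_injective]
    intro (x : K.X n ⟶ S.X₁) (y : K.X n ⟶ S.X₁) (h : x ≫ S.f = y ≫ S.f)
    exact (cancel_mono S.f).1 h
  · rw [AddCommGrpCat.epi_iff_surjective]
    intro (x : K.X n ⟶ S.X₃)
    exact ⟨Projective.factorThru x S.g, Projective.factorThru_comp x S.g⟩

/-- For a complex `K` of projectives, the functors `B ↦ H^n(Hom(K_•, B))`, `n : ℤ`, with the
connecting homomorphisms of the short exact sequences of cochain complexes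
`0 ⟶ Hom(K_•, S.X₁) ⟶ Hom(K_•, S.X₂) ⟶ Hom(K_•, S.X₃) ⟶ 0`. -/
def homCohomologicalFunctor (K : ChainComplex C ℤ) (hK : ∀ n, Projective (K.X n)) :
    CohomologicalFunctor C AddCommGrpCat.{v} where
  T n := homComplexFunctor K ⋙ HomologicalComplex.homologyFunctor _ _ n
  additive n := inferInstance
  δ hS n₀ n₁ h := (homComplex_shortExact K hK hS).δ n₀ n₁ h
  δ_naturality hS hS' φ n₀ n₁ h :=
    HomologicalComplex.HomologySequence.δ_naturality ((homComplexFunctor K).mapShortComplex.map φ)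
      (homComplex_shortExact K hK hS) (homComplex_shortExact K hK hS') n₀ n₁ h
  map_comp_map {S} hS n := by
    rw [← Functor.map_comp, S.zero, Functor.map_zero]
  map_comp_δ hS n₀ n₁ h := (homComplex_shortExact K hK hS).comp_δ n₀ n₁ h
  δ_comp_map hS n₀ n₁ h := (homComplex_shortExact K hK hS).δ_comp n₀ n₁ h
  exact₂ hS n := (homComplex_shortExact K hK hS).homology_exact₂ n
  exact₃ hS n₀ n₁ h := (homComplex_shortExact K hK hS).homology_exact₃ n₀ n₁ h
  exact₁ hS n₀ n₁ h := (homComplex_shortExact K hK hS).homology_exact₁ n₀ n₁ h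

/-! ### Complete resolutions and Tate–Farrell Ext-functors -/

/-- `K` is a complete resolution of `A`. -/
structure IsCompleteResolution (A : C) (K : ChainComplex C ℤ) : Prop where
  projective : ∀ n, Projective (K.X n)
  acyclic : K.Acyclic
  /-- In degrees `k ≥ n`, for some `n`, the complex `K` agrees with a projective resolution
  of `A`. -/
  agrees : ∃ (n : ℕ) (P : ProjectiveResolution A)
    (e : ∀ k : ℕ, n ≤ k → (K.X (k : ℤ) ≅ P.complex.X k)),
    ∀ (k : ℕ) (hk : n ≤ k),
      (e (k + 1) (hk.trans k.le_succ)).hom ≫ P.complex.d (k + 1) k =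
        K.d ((k + 1 : ℕ) : ℤ) (k : ℤ) ≫ (e k hk).hom
  hom_acyclic : ∀ Q : C, Projective Q → (homComplex K Q).Acyclic

/-- The Tate–Farrell Ext-functors `B ↦ H^•(Hom(K_•, B))` defined by a complete resolution `K`
of `A`. -/
def tateFarrellExt {A : C} {K : ChainComplex C ℤ} (hK : IsCompleteResolution A K) :
    CohomologicalFunctor C AddCommGrpCat.{v} :=
  homCohomologicalFunctor K hK.projective

end

/-! The Tate–Farrell functors are themselves a Mislin completion of `Ext`; uniqueness of completions
then gives the lemma.

If `U` vanishes on projectives, its connecting maps for `0 ⟶ ΩB ⟶ P ⟶ B ⟶ 0` are isomorphisms, so a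
morphism `T ⟶ U` is determined by its components in high degrees, and any family given there extends
downwards. Hence a morphism to such a `U` that is invertible in high degrees is a Mislin completion
(`isMislinCompletion_of_isIso`).

It remains to identify `H^n(Hom(K, -))` with `Ext^n(A, -)` for large `n`, compatibly with `δ`. Put
`Z n = coker (K (n + 1) ⟶ K n)`. A cocycle is a map `Z n ⟶ B`, and it is sent to its Yoneda product
with a class in `Ext^n(A, Z n)`. That class is spliced from the extensions `0 ⟶ Z (k + 1) ⟶ K k ⟶ Z
k ⟶ 0`, and shifts `Ext` bijectively in positive degrees because the middle terms are projective
(`isShiftClass_extClass`). Bijectivity is `isIso_homologyToExt`; compatibility with `δ` is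
`homologyToExt_δ`. -/

namespace CohomologicalFunctor

/-! ### Dimension shifting and a criterion for Mislin completions. -/

section Extension

variable {C : Type u} [Category.{v} C] [Abelian C] {D : Type u'} [Category.{v'} D] [Abelian D]

/-- The morphisms `T ⟶ U` given only in degrees `≥ m`. -/
structure HomFrom (m : ℤ) (T U : CohomologicalFunctor C D) where
  /-- the natural transformation in degree `n` -/
  app : ∀ n : ℤ, m ≤ n → (T.T n ⟶ U.T n)
  comm : ∀ {S : ShortComplex C} (hS : S.ShortExact) (n₀ n₁ : ℤ) (h : n₀ + 1 = n₁)
    (h₀ : m ≤ n₀) (h₁ : m ≤ n₁),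
    T.δ hS n₀ n₁ h ≫ (app n₁ h₁).app S.X₁ = (app n₀ h₀).app S.X₃ ≫ U.δ hS n₀ n₁ h

/-- In the long exact sequence both neighbours of `δ` are values of `U` at the projective `S.X₂`,
hence zero. -/
theorem isIso_δ {U : CohomologicalFunctor C D} (hU : U.VanishesOnProjectives)
    {S : ShortComplex C} (hS : S.ShortExact) (hP : Projective S.X₂) (n₀ n₁ : ℤ)
    (h : n₀ + 1 = n₁) : IsIso (U.δ hS n₀ n₁ h) := by
  have : Mono (U.δ hS n₀ n₁ h) :=
    (ShortComplex.exact_iff_mono _ ((hU _ hP n₀).eq_of_src _ _)).1 (U.exact₃ hS n₀ n₁ h)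
  have : Epi (U.δ hS n₀ n₁ h) :=
    (ShortComplex.exact_iff_epi _ ((hU _ hP n₁).eq_of_tgt _ _)).1 (U.exact₁ hS n₀ n₁ h)
  exact isIso_of_mono_of_epi _

/-- Mislin completions are unique up to isomorphism. -/
theorem IsMislinCompletion.nonempty_iso {T U V : CohomologicalFunctor C D} {ν : T ⟶ U} {ν' : T ⟶ V}
    (h : IsMislinCompletion ν) (h' : IsMislinCompletion ν') : Nonempty (U ≅ V) := by
  obtain ⟨f, hf, -⟩ := h.existsUnique_factor V h'.vanishes ν'
  obtain ⟨g, hg, -⟩ := h'.existsUnique_factor U h.vanishes ν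
  exact ⟨⟨f, g,
    (h.existsUnique_factor U h.vanishes ν).unique (by rw [← Category.assoc, hf, hg])
      (Category.comp_id _),
    (h'.existsUnique_factor V h'.vanishes ν').unique (by rw [← Category.assoc, hg, hf])
      (Category.comp_id _)⟩⟩

variable [EnoughProjectives C]

/-- The chosen short complex `ΩB ⟶ P ⟶ B` with `P` projective. -/
noncomputable abbrev projectivePresentation (B : C) : ShortComplex C :=
  ShortComplex.mk (kernel.ι (Projective.π B)) (Projective.π B) (kernel.condition _)

theorem projectivePresentation_shortExact (B : C) : (projectivePresentation B).ShortExact where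
  exact := ShortComplex.exact_of_f_is_kernel _ (kernelIsKernel _)
  mono_f := inferInstanceAs (Mono (kernel.ι (Projective.π B)))
  epi_g := inferInstanceAs (Epi (Projective.π B))

/-- A morphism into the end of a short exact sequence lifts to the projective presentation. -/
theorem exists_hom_of_projectivePresentation {B : C} {S : ShortComplex C} (hS : S.ShortExact)
    (f : B ⟶ S.X₃) : ∃ φ : projectivePresentation B ⟶ S, φ.τ₃ = f := by
  have := hS.mono_f
  have := hS.epi_g
  let τ₂ : (projectivePresentation B).X₂ ⟶ S.X₂ := Projective.factorThru (Projective.π B ≫ f) S.g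
  have h₂ : τ₂ ≫ S.g = (projectivePresentation B).g ≫ f := Projective.factorThru_comp _ _
  refine ⟨{ τ₁ := hS.exact.lift ((projectivePresentation B).f ≫ τ₂) ?_, τ₂ := τ₂, τ₃ := f
            comm₁₂ := hS.exact.lift_f _ _, comm₂₃ := h₂ }, rfl⟩
  rw [Category.assoc, h₂, ← Category.assoc, ShortComplex.zero, zero_comp]

variable {T U : CohomologicalFunctor C D} (hU : U.VanishesOnProjectives)

/-- The natural transformation in degree `n₀` obtained from one in degree `n₁ = n₀ + 1` by
dimension shifting. -/
noncomputable def shiftDown (n₀ n₁ : ℤ) (h : n₀ + 1 = n₁) (α : T.T n₁ ⟶ U.T n₁) :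
    T.T n₀ ⟶ U.T n₀ where
  app B :=
    haveI := isIso_δ hU (projectivePresentation_shortExact B)
      (inferInstanceAs (Projective (Projective.over B))) n₀ n₁ h
    T.δ (projectivePresentation_shortExact B) n₀ n₁ h ≫ α.app _ ≫
      inv (U.δ (projectivePresentation_shortExact B) n₀ n₁ h)
  naturality B B' f := by
    have := isIso_δ hU (projectivePresentation_shortExact B)
      (inferInstanceAs (Projective (Projective.over B))) n₀ n₁ h
    have := isIso_δ hU (projectivePresentation_shortExact B')
      (inferInstanceAs (Projective (Projective.over B'))) n₀ n₁ h
    -- `φ` depends on a choice of lift, but the component at each object does not involve it.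
    obtain ⟨φ, rfl⟩ := exists_hom_of_projectivePresentation (projectivePresentation_shortExact B') f
    have h₁ := T.δ_naturality (projectivePresentation_shortExact B)
      (projectivePresentation_shortExact B') φ n₀ n₁ h
    have h₂ := U.δ_naturality (projectivePresentation_shortExact B)
      (projectivePresentation_shortExact B') φ n₀ n₁ h
    dsimp only at h₁ h₂ ⊢
    rw [← cancel_mono (U.δ (projectivePresentation_shortExact B') n₀ n₁ h)]
    simp only [Category.assoc, IsIso.inv_hom_id, Category.comp_id]
    rw [← reassoc_of% h₁, ← h₂, IsIso.inv_hom_id_assoc, α.naturality]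

/-- A morphism from the presentation of `S.X₃` to `S` over the identity expresses both connecting
maps of `S` through those of the presentation, where the square commutes by construction. -/
theorem shiftDown_comm (n₀ n₁ : ℤ) (h : n₀ + 1 = n₁) (α : T.T n₁ ⟶ U.T n₁)
    {S : ShortComplex C} (hS : S.ShortExact) :
    T.δ hS n₀ n₁ h ≫ α.app S.X₁ = (shiftDown hU n₀ n₁ h α).app S.X₃ ≫ U.δ hS n₀ n₁ h := by
  obtain ⟨φ, hφ⟩ := exists_hom_of_projectivePresentation hS (𝟙 S.X₃)
  have := isIso_δ hU (projectivePresentation_shortExact S.X₃)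
      (inferInstanceAs (Projective (Projective.over S.X₃))) n₀ n₁ h
  have h₁ := T.δ_naturality (projectivePresentation_shortExact S.X₃) hS φ n₀ n₁ h
  have h₂ := U.δ_naturality (projectivePresentation_shortExact S.X₃) hS φ n₀ n₁ h
  dsimp only at h₁ h₂ hφ
  rw [hφ, CategoryTheory.Functor.map_id, Category.id_comp] at h₁ h₂
  rw [← h₁, ← h₂, Category.assoc, α.naturality]
  simp [shiftDown]

/-- The natural transformations of the extension of a morphism given in degrees `≥ m`. -/
noncomputable def HomFrom.extendApp {m : ℤ} (f : HomFrom m T U) (n : ℤ) : T.T n ⟶ U.T n :=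
  if h : m ≤ n then f.app n h else shiftDown hU n (n + 1) rfl (HomFrom.extendApp f (n + 1))
-- The recursion climbs from `n` to `m`, so the distance to `m` decreases.
termination_by (m - n).toNat
decreasing_by omega

theorem HomFrom.extendApp_of_le {m : ℤ} (f : HomFrom m T U) (n : ℤ) (h : m ≤ n) :
    f.extendApp hU n = f.app n h := by
  rw [extendApp, dif_pos h]

theorem HomFrom.extendApp_of_lt {m : ℤ} (f : HomFrom m T U) (n : ℤ) (h : n < m) :
    f.extendApp hU n = shiftDown hU n (n + 1) rfl (f.extendApp hU (n + 1)) := by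
  rw [extendApp, dif_neg (not_le.2 h)]

/-- A morphism given in degrees `≥ m` to a cohomological functor vanishing on projectives extends
to all degrees. -/
noncomputable def HomFrom.extend {m : ℤ} (f : HomFrom m T U) : T ⟶ U :=
  Hom.mk (f.extendApp hU) (by
    rintro S hS n₀ n₁ rfl
    by_cases h : m ≤ n₀
    · rw [f.extendApp_of_le hU n₀ h, f.extendApp_of_le hU (n₀ + 1) (by omega)]
      exact f.comm hS n₀ _ rfl h _
    · rw [f.extendApp_of_lt hU n₀ (not_le.1 h)]
      exact shiftDown_comm hU n₀ _ rfl _ hS)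

theorem HomFrom.extend_app {m : ℤ} (f : HomFrom m T U) (n : ℤ) (h : m ≤ n) :
    Hom.app (f.extend hU) n = f.app n h :=
  f.extendApp_of_le hU n h

/-- Morphisms to a cohomological functor vanishing on projectives are determined by their
components in high degrees. -/
theorem hom_ext_of_le (hU : U.VanishesOnProjectives) (m : ℤ) {f g : T ⟶ U}
    (h : ∀ n, m ≤ n → Hom.app f n = Hom.app g n) : f = g := by
  -- Compatibility with the monomorphism `U.δ` of a presentation determines degree `n` from degree
  -- `n + 1`.
  have step (n : ℤ) (hn : Hom.app f (n + 1) = Hom.app g (n + 1)) : Hom.app f n = Hom.app g n := by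
    ext B : 2
    have := isIso_δ hU (projectivePresentation_shortExact B)
      (inferInstanceAs (Projective (Projective.over B))) n (n + 1) rfl
    have hf := Hom.comm f (projectivePresentation_shortExact B) n (n + 1) rfl
    have hg := Hom.comm g (projectivePresentation_shortExact B) n (n + 1) rfl
    rw [hn] at hf
    exact (cancel_mono (U.δ (projectivePresentation_shortExact B) n (n + 1) rfl)).1
      (hf.symm.trans hg)
  have key (k : ℕ) : ∀ n, m - k ≤ n → Hom.app f n = Hom.app g n := by
    induction k with
    | zero => simpa using h
    | succ k ih =>
      intro n hn
      exact step n (ih (n + 1) (by push_cast at hn; omega))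
  exact Hom.ext (funext fun n => key (m - n).toNat n (by omega))

/-- A morphism to a cohomological functor vanishing on projectives which is an isomorphism in
high degrees is a Mislin completion. -/
theorem isMislinCompletion_of_isIso (hU : U.VanishesOnProjectives) (m : ℤ) (ν : T ⟶ U)
    (hν : ∀ n, m ≤ n → IsIso (Hom.app ν n)) : IsMislinCompletion ν where
  vanishes := hU
  existsUnique_factor V hV f := by
    -- In degrees `≥ m` the factorization is forced to be `ν⁻¹ ≫ f`.
    let p : HomFrom m U V :=
      { app := fun n h => haveI := hν n h; inv (Hom.app ν n) ≫ Hom.app f n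
        comm := fun {S} hS n₀ n₁ h h₀ h₁ => by
          have := hν n₀ h₀
          have := hν n₁ h₁
          have e := Hom.comm ν hS n₀ n₁ h
          have e' := Hom.comm f hS n₀ n₁ h
          rw [← cancel_epi ((Hom.app ν n₀).app S.X₃), ← reassoc_of% e]
          simp only [← NatTrans.comp_app_assoc,
            ← NatTrans.comp_app, IsIso.hom_inv_id_assoc]
          exact e' }
    refine ⟨p.extend hV, hom_ext_of_le hV m fun n h => ?_, fun g hg =>
      hom_ext_of_le hV m fun n h => ?_⟩
    · have := hν n h
      change Hom.app ν n ≫ Hom.app (p.extend hV) n = _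
      rw [p.extend_app hV n h, IsIso.hom_inv_id_assoc]
    · have := hν n h
      rw [p.extend_app hV n h, IsIso.eq_inv_comp, ← hg]
      rfl

end Extension

end CohomologicalFunctor

/-! ### Syzygies and the spliced Yoneda classes. -/

section UniversalClass

open CategoryTheory.Abelian

variable {C : Type u} [Category.{v} C] [Abelian C]

/-- `L.opcycles j` is the cokernel of `d i j`, hence of `fromOpcycles i j`, since `pOpcycles i` is
epi. Exactness at `i` serves only to make the first map mono. -/
theorem opcycles_shortExact {ι : Type*} {c : ComplexShape ι} (L : HomologicalComplex C c) {i j : ι}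
    (hij : c.Rel i j) (h : L.ExactAt i) :
    (ShortComplex.mk (L.fromOpcycles i j) (L.pOpcycles j)
      (by rw [← cancel_epi (L.pOpcycles i)]; simp)).ShortExact where
  exact := by
    refine ShortComplex.exact_of_g_is_cokernel _ (CokernelCofork.IsColimit.ofπ _ _
      (fun k hk => L.descOpcycles k i (c.prev_eq' hij) ?_) (fun _ _ => L.p_descOpcycles _ _ _ _)
      fun k hk b hb => ?_)
    · rw [← L.p_fromOpcycles, Category.assoc]
      exact (congrArg _ hk).trans comp_zero
    · rw [← cancel_epi (L.pOpcycles j)]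
      exact hb.trans (L.p_descOpcycles _ _ _ _).symm
  mono_f := by
    obtain rfl := c.next_eq' hij
    have e : L.fromOpcycles i (c.next i) = (L.sc i).fromOpcycles :=
      (cancel_epi (L.pOpcycles i)).1
        ((L.p_fromOpcycles i (c.next i)).trans (L.sc i).p_fromOpcycles.symm)
    exact (congrArg (fun f : L.opcycles i ⟶ L.X (c.next i) => Mono f) e).mpr
      ((L.sc i).exact_iff_mono_fromOpcycles.1 h)
  epi_g := inferInstanceAs (Epi (L.pOpcycles j))

/-- Complexes that agree in two consecutive degrees have isomorphic opcycles. -/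
theorem nonempty_opcycles_iso {ι ι' : Type*} {c : ComplexShape ι} {c' : ComplexShape ι'}
    {L : HomologicalComplex C c} {L' : HomologicalComplex C c'} {i j : ι} {i' j' : ι'}
    (h : c.prev j = i) (h' : c'.prev j' = i') (e : L.X i ≅ L'.X i') (e' : L.X j ≅ L'.X j')
    (w : L.d i j ≫ e'.hom = e.hom ≫ L'.d i' j') : Nonempty (L.opcycles j ≅ L'.opcycles j') :=
  ⟨IsColimit.coconePointUniqueUpToIso (L.opcyclesIsCokernel i j h) (colimit.isColimit _) ≪≫
    cokernel.mapIso _ _ e e' w ≪≫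
    IsColimit.coconePointUniqueUpToIso (colimit.isColimit _) (L'.opcyclesIsCokernel i' j' h')⟩

/-- The short exact sequence `0 ⟶ Z (n + 1) ⟶ K n ⟶ Z n ⟶ 0` with `Z n = coker (d (n + 1) n)`. -/
theorem opcycles_shortExact_of_acyclic {K : ChainComplex C ℤ} (hK : K.Acyclic) (n : ℕ) :
    (ShortComplex.mk (K.fromOpcycles ((n + 1 : ℕ) : ℤ) (n : ℤ)) (K.pOpcycles (n : ℤ))
      (by rw [← cancel_epi (K.pOpcycles _)]; simp)).ShortExact :=
  opcycles_shortExact K (by simp) (hK _)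

variable [HasExt.{v} C]

/-- Composition with the class `α` of degree `k` induces bijections from `Ext^j(X, -)` to
`Ext^(k + j)(A, -)` for `j > 0`. -/
def IsShiftClass {A X : C} {k : ℕ} (α : Ext A X k) : Prop :=
  ∀ (B : C) (j l : ℕ) (h : k + (j + 1) = l), Function.Bijective (α.precomp B h)

theorem IsShiftClass.mk₀_iso {A X : C} (e : A ≅ X) : IsShiftClass (Ext.mk₀ e.hom) := by
  intro B j l h
  refine ⟨?_, fun y => ⟨(Ext.mk₀ e.inv).comp y (by omega), ?_⟩⟩
  · rw [injective_iff_map_eq_zero]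
    intro x (hx : (Ext.mk₀ e.hom).comp x h = 0)
    have := congrArg (fun y => (Ext.mk₀ e.inv).comp y (show 0 + l = j + 1 by omega)) hx
    obtain rfl : l = j + 1 := by omega
    simpa using this
  · change (Ext.mk₀ e.hom).comp ((Ext.mk₀ e.inv).comp y _) h = y
    obtain rfl : l = j + 1 := by omega
    simp

theorem IsShiftClass.comp {A X Y : C} {k k' k'' : ℕ} {α : Ext A X k} (hα : IsShiftClass α)
    {β : Ext X Y k'} (hβ : IsShiftClass β) (h : k + k' = k'') : IsShiftClass (α.comp β h) := by
  intro B j l hl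
  have e : ⇑((α.comp β h).precomp B hl) =
      α.precomp B (show k + (k' + j + 1) = l by omega) ∘
        β.precomp B (show k' + (j + 1) = k' + j + 1 by omega) := by
    ext1 x
    exact Ext.comp_assoc _ _ _ h (show k' + (j + 1) = k' + j + 1 by omega) (by omega)
  rw [e]
  -- `β` lands in degree `k' + j + 1`, which is again positive, so `α` applies with index `k' + j`.
  exact (hα B (k' + j) l _).comp (hβ B j (k' + j + 1) (by omega))

/-- Injectivity uses `Ext^(j + 1)(S.X₂, B) = 0`, surjectivity `Ext^(j + 2)(S.X₂, B) = 0`.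
Injectivity could fail on `Hom`, hence the restriction to positive degrees in `IsShiftClass`. -/
theorem isShiftClass_extClass {S : ShortComplex C} (hS : S.ShortExact) (hP : Projective S.X₂) :
    IsShiftClass hS.extClass := by
  intro B j l h
  obtain rfl : l = j + 1 + 1 := by omega
  refine ⟨?_, fun y => ?_⟩
  · rw [injective_iff_map_eq_zero]
    intro x hx
    obtain ⟨y, rfl⟩ := Ext.contravariant_sequence_exact₁ hS B x h hx
    rw [Ext.eq_zero_of_projective y, Ext.comp_zero]
  · exact Ext.contravariant_sequence_exact₃ hS B y (Ext.eq_zero_of_projective _) h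

/-- Start from `A ≅ coker (P 1 ⟶ P 0)` and splice one syzygy sequence at a time. -/
theorem exists_isShiftClass_opcycles {A : C} (P : ProjectiveResolution A) (k : ℕ) :
    ∃ α : Ext A (P.complex.opcycles k) k, IsShiftClass α := by
  induction k with
  | zero =>
    exact ⟨_, IsShiftClass.mk₀_iso (IsColimit.coconePointUniqueUpToIso
      P.isColimitCokernelCofork (P.complex.opcyclesIsCokernel 1 0 (by simp)))⟩
  | succ k ih =>
    obtain ⟨α, hα⟩ := ih
    have hS := opcycles_shortExact P.complex (show (ComplexShape.down ℕ).Rel (k + 1) k from rfl)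
      (P.complex_exactAt_succ k)
    exact ⟨_, hα.comp (isShiftClass_extClass hS (P.projective k)) rfl⟩

variable {A : C} {K : ChainComplex C ℤ}

/-- Agreement in degrees `m` and `m + 1` already identifies the cokernels in degree `m`. -/
theorem IsCompleteResolution.exists_isShiftClass (hK : IsCompleteResolution A K) :
    ∃ (m : ℕ) (α : Ext A (K.opcycles (m : ℤ)) m), IsShiftClass α := by
  obtain ⟨m, P, e, he⟩ := hK.agrees
  obtain ⟨α, hα⟩ := exists_isShiftClass_opcycles P m
  obtain ⟨i⟩ := nonempty_opcycles_iso (L := P.complex) (L' := K) (i := m + 1) (j := m)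
    (i' := ((m + 1 : ℕ) : ℤ)) (j' := (m : ℤ)) (ComplexShape.prev_eq' _ rfl)
    (ComplexShape.prev_eq' _ (by simp)) (e (m + 1) (by omega)).symm (e m le_rfl).symm (by
      rw [Iso.symm_hom, Iso.symm_hom, Iso.comp_inv_eq, Category.assoc, Iso.eq_inv_comp]
      exact he m le_rfl)
  exact ⟨m, _, hα.comp (IsShiftClass.mk₀_iso i) (add_zero m)⟩

/-- The classes in `Ext^n(A, Z n)`, `n ≥ m`, obtained from `α` by splicing the short exact
sequences `0 ⟶ Z (n + 1) ⟶ K n ⟶ Z n ⟶ 0`. -/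
noncomputable def spliceClass (hK : K.Acyclic) {m : ℕ} (α : Ext A (K.opcycles (m : ℤ)) m) (n : ℕ)
    (h : m ≤ n) : Ext A (K.opcycles (n : ℤ)) n :=
  Nat.leRec (motive := fun n _ => Ext A (K.opcycles (n : ℤ)) n) α
    (fun n _ β => β.comp (opcycles_shortExact_of_acyclic hK n).extClass rfl) h

theorem spliceClass_self (hK : K.Acyclic) {m : ℕ} (α : Ext A (K.opcycles (m : ℤ)) m) :
    spliceClass hK α m le_rfl = α :=
  Nat.leRec_self _ _

theorem spliceClass_succ (hK : K.Acyclic) {m : ℕ} (α : Ext A (K.opcycles (m : ℤ)) m) (n : ℕ)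
    (h : m ≤ n) : spliceClass hK α (n + 1) (h.trans n.le_succ) =
      (spliceClass hK α n h).comp (opcycles_shortExact_of_acyclic hK n).extClass rfl :=
  Nat.leRec_succ _ _ h

theorem isShiftClass_spliceClass (hK : K.Acyclic) (hP : ∀ n, Projective (K.X n)) {m : ℕ}
    {α : Ext A (K.opcycles (m : ℤ)) m} (hα : IsShiftClass α) (n : ℕ) (h : m ≤ n) :
    IsShiftClass (spliceClass hK α n h) := by
  induction n, h using Nat.le_induction with
  | base => rwa [spliceClass_self]
  | succ n h ih =>
    have := ih.comp (isShiftClass_extClass (opcycles_shortExact_of_acyclic hK n) (hP n)) rfl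
    rwa [← spliceClass_succ] at this

end UniversalClass

/-! ### Cocycles of `Hom(K, B)` and their map to `Ext`. -/

section HomComplex

open CategoryTheory.Abelian

section Elements

variable {ι : Type*} {c : ComplexShape ι}

/-- The morphism from the free group on one generator which corresponds to an element. -/
def elementHom {G : AddCommGrpCat.{v}} (x : G) : AddCommGrpCat.of (ULift.{v} ℤ) ⟶ G :=
  AddCommGrpCat.ofHom (uliftZMultiplesHom G x)

theorem elementHom_one {G : AddCommGrpCat.{v}} (x : G) : elementHom x (ULift.up 1) = x := by
  change uliftZMultiplesHom G x (ULift.up 1) = x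
  rw [uliftZMultiplesHom_apply_apply]
  exact one_zsmul x

theorem elementHom_comp {G G' : AddCommGrpCat.{v}} (x : G) (f : G ⟶ G') :
    elementHom x ≫ f = elementHom (f x) := by
  ext n
  change f (uliftZMultiplesHom G x n) = uliftZMultiplesHom G' (f x) n
  simp

theorem exists_iCycles_eq (L : HomologicalComplex AddCommGrpCat.{v} c) (i j : ι)
    (hij : c.next i = j) (x : L.X i) (hx : L.d i j x = 0) : ∃ z : L.cycles i, L.iCycles i z = x := by
  have w : elementHom x ≫ L.d i j = 0 := by
    rw [elementHom_comp, hx]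
    ext n
    change uliftZMultiplesHom _ 0 n = 0
    simp
  refine ⟨L.liftCycles (elementHom x) j hij w (ULift.up 1), ?_⟩
  rw [← ConcreteCategory.comp_apply, L.liftCycles_i, elementHom_one]

theorem iCycles_injective (L : HomologicalComplex AddCommGrpCat.{v} c) (i : ι) :
    Function.Injective (L.iCycles i) :=
  (AddCommGrpCat.mono_iff_injective _).1 inferInstance

theorem homologyπ_surjective (L : HomologicalComplex AddCommGrpCat.{v} c) (i : ι) :
    Function.Surjective (L.homologyπ i) :=
  (AddCommGrpCat.epi_iff_surjective _).1 inferInstance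

theorem d_iCycles_eq_zero (L : HomologicalComplex AddCommGrpCat.{v} c) (i j : ι)
    (z : L.cycles i) : L.d i j (L.iCycles i z) = 0 := by
  rw [← ConcreteCategory.comp_apply, L.iCycles_d]
  rfl

theorem iCycles_toCycles (L : HomologicalComplex AddCommGrpCat.{v} c) {i j : ι} (y : L.X i) :
    L.iCycles j (L.toCycles i j y) = L.d i j y := by
  rw [← ConcreteCategory.comp_apply, L.toCycles_i]

theorem iCycles_cyclesMap {L L' : HomologicalComplex AddCommGrpCat.{v} c} (f : L ⟶ L') (i : ι)
    (z : L.cycles i) :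
    L'.iCycles i (HomologicalComplex.cyclesMap f i z) = f.f i (L.iCycles i z) := by
  rw [← ConcreteCategory.comp_apply, HomologicalComplex.cyclesMap_i, ConcreteCategory.comp_apply]

theorem homologyMap_homologyπ {L L' : HomologicalComplex AddCommGrpCat.{v} c} (f : L ⟶ L') (i : ι)
    (z : L.cycles i) : HomologicalComplex.homologyMap f i (L.homologyπ i z) =
      L'.homologyπ i (HomologicalComplex.cyclesMap f i z) := by
  rw [← ConcreteCategory.comp_apply, HomologicalComplex.homologyπ_naturality,
    ConcreteCategory.comp_apply]

theorem homologyπ_eq_zero_of_eq_d (L : HomologicalComplex AddCommGrpCat.{v} c) {i j : ι}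
    (y : L.X i) (z : L.cycles j) (h : L.iCycles j z = L.d i j y) : L.homologyπ j z = 0 := by
  obtain rfl : z = L.toCycles i j y :=
    iCycles_injective L j (h.trans (iCycles_toCycles L y).symm)
  rw [← ConcreteCategory.comp_apply, L.toCycles_comp_homologyπ]
  rfl

/-- A homomorphism on the cycles which vanishes on boundaries descends to homology. -/
noncomputable def descHomologyOfVanish (L : HomologicalComplex AddCommGrpCat.{v} c) (i j : ι)
    (hij : c.prev j = i) {G : AddCommGrpCat.{v}} (f : L.cycles j →+ G)
    (hf : ∀ y : L.X i, f (L.toCycles i j y) = 0) : L.homology j ⟶ G :=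
  (L.homologyIsCokernel i j hij).desc (CokernelCofork.ofπ (AddCommGrpCat.ofHom f) (by
    ext y
    exact hf y))

theorem descHomologyOfVanish_apply (L : HomologicalComplex AddCommGrpCat.{v} c) (i j : ι)
    (hij : c.prev j = i) {G : AddCommGrpCat.{v}} (f : L.cycles j →+ G)
    (hf : ∀ y : L.X i, f (L.toCycles i j y) = 0) (z : L.cycles j) :
    descHomologyOfVanish L i j hij f hf (L.homologyπ j z) = f z :=
  ConcreteCategory.congr_hom ((L.homologyIsCokernel i j hij).fac (CokernelCofork.ofπ
    (AddCommGrpCat.ofHom f) _) WalkingParallelPair.one) z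

/-- The usual zigzag description of `δ` on elements. `δ_eq'` speaks of morphisms from a test object,
so elements enter as maps from the free group `ULift ℤ`. -/
theorem δ_homologyπ_apply {S : ShortComplex (HomologicalComplex AddCommGrpCat.{v} c)}
    (hS : S.ShortExact) (i j : ι) (hij : c.Rel i j) (z : S.X₃.cycles i) (x : S.X₂.X i)
    (w : S.X₁.cycles j) (hx : S.g.f i x = S.X₃.iCycles i z)
    (hw : S.f.f j (S.X₁.iCycles j w) = S.X₂.d i j x) :
    hS.δ i j hij (S.X₃.homologyπ i z) = S.X₁.homologyπ j w := by
  have key := hS.δ_eq' i j hij (elementHom (S.X₃.homologyπ i z))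
    (elementHom (S.X₂.pOpcycles i x)) (elementHom w) (by
      rw [elementHom_comp, elementHom_comp, ← ConcreteCategory.comp_apply,
        ← ConcreteCategory.comp_apply, HomologicalComplex.p_opcyclesMap,
        HomologicalComplex.homology_π_ι, ConcreteCategory.comp_apply, hx,
        ConcreteCategory.comp_apply]) (by
      rw [elementHom_comp, elementHom_comp]
      congr 1
      apply iCycles_injective
      rw [iCycles_cyclesMap, hw, ← ConcreteCategory.comp_apply, ← ConcreteCategory.comp_apply,
        HomologicalComplex.opcyclesToCycles_iCycles,
        HomologicalComplex.p_fromOpcycles])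
  rw [elementHom_comp, elementHom_comp] at key
  have := ConcreteCategory.congr_hom key (ULift.up 1)
  rwa [elementHom_one, elementHom_one] at this

end Elements

variable {C : Type u} [Category.{v} C] [Abelian C] (K : ChainComplex C ℤ)

/-- The morphism `K n ⟶ B` underlying a cocycle of `Hom(K, B)`. -/
noncomputable def cocycle {B : C} {n : ℤ} (z : (homComplex K B).cycles n) : K.X n ⟶ B :=
  (homComplex K B).iCycles n z

theorem cocycle_add {B : C} {n : ℤ} (z z' : (homComplex K B).cycles n) :
    cocycle K (z + z') = cocycle K z + cocycle K z' :=
  map_add ((homComplex K B).iCycles n).hom z z'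

theorem d_cocycle {B : C} {n : ℤ} (z : (homComplex K B).cycles n) (j : ℤ) :
    K.d j n ≫ cocycle K z = 0 :=
  d_iCycles_eq_zero (homComplex K B) n j z

/-- The morphism `coker (d (n + 1) n) ⟶ B` corresponding to a cocycle `K n ⟶ B`. -/
noncomputable def cocycleHom (B : C) (n : ℤ) :
    (homComplex K B).cycles n →+ (K.opcycles n ⟶ B) :=
  AddMonoidHom.mk' (fun z => K.descOpcycles (cocycle K z) (n + 1) (by simp) (d_cocycle K z _))
    (fun z z' => by
      rw [← cancel_epi (K.pOpcycles n), Preadditive.comp_add, K.p_descOpcycles,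
        K.p_descOpcycles, K.p_descOpcycles, cocycle_add])

theorem p_cocycleHom {B : C} {n : ℤ} (z : (homComplex K B).cycles n) :
    K.pOpcycles n ≫ cocycleHom K B n z = cocycle K z :=
  K.p_descOpcycles (cocycle K z) (n + 1) (by simp) (d_cocycle K z _)

theorem cocycleHom_surjective (B : C) (n : ℤ) : Function.Surjective (cocycleHom K B n) := by
  intro φ
  obtain ⟨z, hz⟩ := exists_iCycles_eq (homComplex K B) n (n + 1) (by simp)
    (show K.X n ⟶ B from K.pOpcycles n ≫ φ) (by
      change K.d (n + 1) n ≫ K.pOpcycles n ≫ φ = 0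
      rw [K.d_pOpcycles_assoc, zero_comp])
  exact ⟨z, (cancel_epi (K.pOpcycles n)).1 ((p_cocycleHom K z).trans hz)⟩

theorem cocycle_cyclesMap {B B' : C} (g : B ⟶ B') {n : ℤ} (z : (homComplex K B).cycles n) :
    cocycle K (B := B') (HomologicalComplex.cyclesMap ((homComplexFunctor K).map g) n z) =
      cocycle K z ≫ g :=
  iCycles_cyclesMap ((homComplexFunctor K).map g) n z

theorem cocycleHom_cyclesMap {B B' : C} (g : B ⟶ B') {n : ℤ} (z : (homComplex K B).cycles n) :
    cocycleHom K B' n (HomologicalComplex.cyclesMap ((homComplexFunctor K).map g) n z) =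
      cocycleHom K B n z ≫ g := by
  apply (cancel_epi (K.pOpcycles n)).1
  exact (p_cocycleHom K _).trans ((cocycle_cyclesMap K g z).trans
    (by rw [← p_cocycleHom, Category.assoc]))

/-- Coboundaries thus become maps factoring through `K i`, which a class dying in `K i` annihilates;
this makes `homologyToExt` well defined. -/
theorem cocycleHom_toCycles (B : C) (i j : ℤ) (y : (homComplex K B).X i) :
    cocycleHom K B j ((homComplex K B).toCycles i j y) =
      K.fromOpcycles j i ≫ (show K.X i ⟶ B from y) := by
  apply (cancel_epi (K.pOpcycles j)).1
  rw [p_cocycleHom, K.p_fromOpcycles_assoc]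
  exact iCycles_toCycles (homComplex K B) y

variable {K} [HasExt.{v} C]

/-- If the class `α` becomes zero in `K i`, composition with `α` maps the cohomology of
`Hom(K, B)` in degree `j` to `Ext^n(A, B)`. -/
noncomputable def homologyToExt {A : C} {i j : ℤ} (hij : i + 1 = j) {n : ℕ}
    (α : Ext A (K.opcycles j) n)
    (hα : α.comp (Ext.mk₀ (K.fromOpcycles j i)) (add_zero n) = 0) (B : C) :
    (homComplex K B).homology j ⟶ (extFunctorObj A n).obj B :=
  descHomologyOfVanish (homComplex K B) i j (by simp [← hij])
    (AddMonoidHom.mk' (fun z => α.comp (Ext.mk₀ (cocycleHom K B j z)) (add_zero n))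
      (fun z z' => by rw [map_add, Ext.mk₀_add, Ext.comp_add]) :
      (homComplex K B).cycles j →+ Ext A B n)
    (fun y => by
      change α.comp (Ext.mk₀ (cocycleHom K B j ((homComplex K B).toCycles i j y)))
        (add_zero n) = 0
      rw [cocycleHom_toCycles, ← Ext.mk₀_comp_mk₀, ← Ext.comp_assoc_of_third_deg_zero, hα,
        Ext.zero_comp])

theorem homologyToExt_homologyπ {A : C} {i j : ℤ} (hij : i + 1 = j) {n : ℕ}
    (α : Ext A (K.opcycles j) n)
    (hα : α.comp (Ext.mk₀ (K.fromOpcycles j i)) (add_zero n) = 0) {B : C}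
    (z : (homComplex K B).cycles j) :
    homologyToExt hij α hα B ((homComplex K B).homologyπ j z) =
      α.comp (Ext.mk₀ (cocycleHom K B j z)) (add_zero n) :=
  descHomologyOfVanish_apply _ _ _ _ _ _ z

theorem homologyToExt_naturality {A : C} {i j : ℤ} (hij : i + 1 = j) {n : ℕ}
    (α : Ext A (K.opcycles j) n)
    (hα : α.comp (Ext.mk₀ (K.fromOpcycles j i)) (add_zero n) = 0) {B B' : C} (g : B ⟶ B') :
    HomologicalComplex.homologyMap ((homComplexFunctor K).map g) j ≫ homologyToExt hij α hα B' =
      homologyToExt hij α hα B ≫ (extFunctorObj A n).map g := by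
  ext x
  obtain ⟨z, rfl⟩ := homologyπ_surjective (homComplex K B) j x
  change homologyToExt hij α hα B' (HomologicalComplex.homologyMap ((homComplexFunctor K).map g) j
    ((homComplex K B).homologyπ j z)) =
    (homologyToExt hij α hα B ((homComplex K B).homologyπ j z)).comp (Ext.mk₀ g) (add_zero n)
  have e := homologyMap_homologyπ ((homComplexFunctor K).map g) j z
  refine (congrArg (homologyToExt hij α hα B') e).trans
    ((homologyToExt_homologyπ hij α hα _).trans ?_)
  rw [homologyToExt_homologyπ, cocycleHom_cyclesMap, ← Ext.mk₀_comp_mk₀,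
    Ext.comp_assoc_of_third_deg_zero]

end HomComplex

/-! ### Bijectivity of the comparison and its compatibility with `δ`. -/

section Comparison

open CategoryTheory.Abelian

variable {C : Type u} [Category.{v} C] [Abelian C] {K : ChainComplex C ℤ} [HasExt.{v} C]

theorem comp_extClass_comp_mk₀_f {A : C} {S : ShortComplex C} (hS : S.ShortExact) {n n' : ℕ}
    (α : Ext A S.X₃ n) (h : n + 1 = n') :
    (α.comp hS.extClass h).comp (Ext.mk₀ S.f) (add_zero n') = 0 := by
  rw [Ext.comp_assoc_of_third_deg_zero, hS.extClass_comp, Ext.comp_zero]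

/-- Surjectivity of the comparison: shifting writes `y` as `α` times a class in `Ext^1(S.X₃, B)`,
which comes from `Hom(S.X₁, B)` because `Ext^1(S.X₂, B) = 0`. -/
theorem IsShiftClass.exists_comp_mk₀_eq {A : C} {S : ShortComplex C} (hS : S.ShortExact)
    (hP : Projective S.X₂) {n n' : ℕ} {α : Ext A S.X₃ n} (hα : IsShiftClass α) (h : n + 1 = n')
    {B : C} (y : Ext A B n') :
    ∃ φ : S.X₁ ⟶ B, (α.comp hS.extClass h).comp (Ext.mk₀ φ) (add_zero n') = y := by
  obtain ⟨γ, rfl⟩ := (hα B 0 n' h).2 y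
  obtain ⟨x, rfl⟩ := Ext.contravariant_sequence_exact₃ hS B γ
    (Ext.eq_zero_of_projective (n := 0) _) (add_zero 1)
  obtain ⟨φ, rfl⟩ := (Ext.mk₀_bijective _ _).2 x
  exact ⟨φ, Ext.comp_assoc_of_third_deg_zero _ _ _ _⟩

/-- Injectivity of the comparison: shifting cancels `α` in degree 1, and exactness at `Hom(S.X₁, B)`
extends `φ` over `S.X₂`. -/
theorem IsShiftClass.exists_comp_eq_of_comp_mk₀_eq_zero {A : C} {S : ShortComplex C}
    (hS : S.ShortExact) {n n' : ℕ} {α : Ext A S.X₃ n} (hα : IsShiftClass α) (h : n + 1 = n')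
    {B : C} (φ : S.X₁ ⟶ B)
    (hφ : (α.comp hS.extClass h).comp (Ext.mk₀ φ) (add_zero n') = 0) :
    ∃ y : S.X₂ ⟶ B, S.f ≫ y = φ := by
  rw [Ext.comp_assoc_of_third_deg_zero] at hφ
  have h₀ := (injective_iff_map_eq_zero _).1 (hα B 0 n' h).1 _ hφ
  obtain ⟨x, hx⟩ := Ext.contravariant_sequence_exact₁ hS B (Ext.mk₀ φ) (add_zero 1) h₀
  obtain ⟨y, rfl⟩ := (Ext.mk₀_bijective _ _).2 x
  rw [Ext.mk₀_comp_mk₀] at hx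
  exact ⟨y, (Ext.mk₀_bijective _ _).1 hx⟩

/-- Both sides are `Ext^1(Z i, B)`: the cokernel of `Hom(K i, B) ⟶ Hom(Z j, B)` on the left, the
shift by `β` on the right. -/
theorem isIso_homologyToExt {A : C} {i j : ℤ} (hij : i + 1 = j) {n n' : ℕ}
    {w : K.fromOpcycles j i ≫ K.pOpcycles i = 0}
    (hS : (ShortComplex.mk (K.fromOpcycles j i) (K.pOpcycles i) w).ShortExact)
    (hP : Projective (K.X i)) {β : Ext A (K.opcycles i) n} (hβ : IsShiftClass β) (h : n + 1 = n')
    (α : Ext A (K.opcycles j) n') (hαβ : α = β.comp hS.extClass h)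
    (hα : α.comp (Ext.mk₀ (K.fromOpcycles j i)) (add_zero n') = 0) (B : C) :
    IsIso (homologyToExt hij α hα B) := by
  subst hαβ
  rw [ConcreteCategory.isIso_iff_bijective]
  constructor
  · refine (injective_iff_map_eq_zero (homologyToExt hij _ hα B).hom).2 fun x hx => ?_
    obtain ⟨z, rfl⟩ := homologyπ_surjective (homComplex K B) j x
    obtain ⟨y, hy⟩ := hβ.exists_comp_eq_of_comp_mk₀_eq_zero hS h (cocycleHom K B j z)
      ((homologyToExt_homologyπ hij _ hα z).symm.trans hx)
    refine homologyπ_eq_zero_of_eq_d (homComplex K B) (i := i) y z ?_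
    change cocycle K z = K.d j i ≫ y
    rw [← p_cocycleHom, ← hy, ← K.p_fromOpcycles, Category.assoc]
  · intro y
    obtain ⟨φ, hφ⟩ := hβ.exists_comp_mk₀_eq hS hP h (B := B) y
    obtain ⟨z, rfl⟩ := cocycleHom_surjective K B j φ
    exact ⟨_, (homologyToExt_homologyπ hij _ hα z).trans hφ⟩

/-- Lifting a cocycle along `S.g` gives a morphism `φ` from the syzygy sequence to `S`. Its `τ₁`
represents `δ` of the cocycle, and naturality of `extClass` along `φ` is the claim. -/
theorem homologyToExt_δ (hK : ∀ n, Projective (K.X n)) {A : C} {i j l : ℤ} (hij : i + 1 = j)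
    (hjl : j + 1 = l) {n n' : ℕ} {w : K.fromOpcycles l j ≫ K.pOpcycles j = 0}
    (hZ : (ShortComplex.mk (K.fromOpcycles l j) (K.pOpcycles j) w).ShortExact) (h : n + 1 = n')
    (α : Ext A (K.opcycles j) n)
    (hα : α.comp (Ext.mk₀ (K.fromOpcycles j i)) (add_zero n) = 0)
    (α' : Ext A (K.opcycles l) n') (hαα' : α' = α.comp hZ.extClass h)
    (hα' : α'.comp (Ext.mk₀ (K.fromOpcycles l j)) (add_zero n') = 0)
    {S : ShortComplex C} (hS : S.ShortExact) :
    (homComplex_shortExact K hK hS).δ j l hjl ≫ homologyToExt hjl α' hα' S.X₁ =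
      homologyToExt hij α hα S.X₃ ≫ AddCommGrpCat.ofHom (hS.extClass.postcomp A h) := by
  subst hαα'
  ext x
  obtain ⟨z, rfl⟩ := homologyπ_surjective (homComplex K S.X₃) j x
  have := hK j
  have := hS.epi_g
  have := hS.mono_f
  let τ₂ : K.X j ⟶ S.X₂ := Projective.factorThru (cocycle K z) S.g
  have h₂ : τ₂ ≫ S.g = K.pOpcycles j ≫ cocycleHom K S.X₃ j z :=
    (Projective.factorThru_comp _ _).trans (p_cocycleHom K z).symm
  let φ : ShortComplex.mk (K.fromOpcycles l j) (K.pOpcycles j) w ⟶ S :=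
    { τ₁ := hS.exact.lift (K.fromOpcycles l j ≫ τ₂) (by
        rw [Category.assoc, h₂, reassoc_of% w, zero_comp])
      τ₂ := τ₂
      τ₃ := cocycleHom K S.X₃ j z
      comm₁₂ := hS.exact.lift_f _ _
      comm₂₃ := h₂ }
  obtain ⟨t, ht⟩ := cocycleHom_surjective K S.X₁ l φ.τ₁
  have e := δ_homologyπ_apply (homComplex_shortExact K hK hS) j l hjl z τ₂ t
    (h₂.trans (p_cocycleHom K z)) (by
      change cocycle K t ≫ S.f = K.d l j ≫ τ₂
      rw [← p_cocycleHom, ht, Category.assoc, ← K.p_fromOpcycles, Category.assoc]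
      exact congrArg _ φ.comm₁₂)
  refine (congrArg (homologyToExt hjl _ hα' S.X₁) e).trans
    ((homologyToExt_homologyπ hjl _ hα' t).trans ?_)
  change _ = (homologyToExt hij α hα S.X₃ ((homComplex K S.X₃).homologyπ j z)).comp hS.extClass h
  rw [homologyToExt_homologyπ, ht, Ext.comp_assoc_of_third_deg_zero,
    ShortComplex.ShortExact.extClass_naturality hZ hS φ, Ext.comp_assoc_of_second_deg_zero]

end Comparison

/-! ### The comparison in high degrees and the conclusion. -/

section TateFarrell

open CategoryTheory.Abelian

variable {C : Type u} [Category.{v} C] [Abelian C] {A : C} {K : ChainComplex C ℤ}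

section

variable [HasExt.{v} C] {m : ℕ} (hK : K.Acyclic) (hP : ∀ n, Projective (K.X n))
  (α : Ext A (K.opcycles (m : ℤ)) m)

theorem spliceClass_succ_comp_mk₀ (k : ℕ) (h : m ≤ k) :
    (spliceClass hK α (k + 1) (h.trans k.le_succ)).comp
      (Ext.mk₀ (K.fromOpcycles ((k + 1 : ℕ) : ℤ) (k : ℤ))) (add_zero (k + 1)) = 0 := by
  have := comp_extClass_comp_mk₀_f (opcycles_shortExact_of_acyclic hK k)
    (spliceClass hK α k h) rfl
  rwa [← spliceClass_succ] at this

/-- The comparison `H^(k + 1)(Hom(K, -)) ⟶ Ext^(k + 1)(A, -)`. -/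
noncomputable def homCohomologyToExt (k : ℕ) (h : m ≤ k) :
    (homCohomologicalFunctor K hP).T ((k + 1 : ℕ) : ℤ) ⟶
      (extCohomologicalFunctor A).T ((k + 1 : ℕ) : ℤ) where
  app B := homologyToExt (by simp) (spliceClass hK α (k + 1) (h.trans k.le_succ))
    (spliceClass_succ_comp_mk₀ hK α k h) B
  naturality _ _ g := homologyToExt_naturality (by simp) _ (spliceClass_succ_comp_mk₀ hK α k h) g

theorem isIso_homCohomologyToExt (hα : IsShiftClass α) (k : ℕ) (h : m ≤ k) :
    IsIso (homCohomologyToExt hK hP α k h) := by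
  have (B : C) : IsIso ((homCohomologyToExt hK hP α k h).app B) :=
    isIso_homologyToExt (by simp) (opcycles_shortExact_of_acyclic hK k) (hP _)
      (isShiftClass_spliceClass hK hP hα k h) rfl _ (spliceClass_succ hK α k h)
      (spliceClass_succ_comp_mk₀ hK α k h) B
  exact NatIso.isIso_of_isIso_app _

theorem homCohomologyToExt_comm (k : ℕ) (h : m ≤ k) {S : ShortComplex C} (hS : S.ShortExact)
    (e : ((k + 1 : ℕ) : ℤ) + 1 = ((k + 2 : ℕ) : ℤ)) :
    (homCohomologicalFunctor K hP).δ hS _ _ e ≫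
        (homCohomologyToExt hK hP α (k + 1) (h.trans k.le_succ)).app S.X₁ =
      (homCohomologyToExt hK hP α k h).app S.X₃ ≫ (extCohomologicalFunctor A).δ hS _ _ e :=
  homologyToExt_δ hP (by simp) e (opcycles_shortExact_of_acyclic hK (k + 1)) rfl _
    (spliceClass_succ_comp_mk₀ hK α k h) _ (spliceClass_succ hK α (k + 1) (h.trans k.le_succ))
    (spliceClass_succ_comp_mk₀ hK α (k + 1) (h.trans k.le_succ)) hS

/-- The inverse of the comparison in degrees `> m`, as a partially defined morphism of
cohomological functors. -/
theorem exists_homFrom_isIso (hK : K.Acyclic) (hP : ∀ n, Projective (K.X n))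
    (α : Ext A (K.opcycles (m : ℤ)) m) (hα : IsShiftClass α) :
    ∃ f : CohomologicalFunctor.HomFrom (m + 1 : ℤ) (extCohomologicalFunctor A)
      (homCohomologicalFunctor K hP), ∀ n h, IsIso (f.app n h) := by
  have ex (n : ℤ) (h : (m + 1 : ℤ) ≤ n) : ∃ k : ℕ, m ≤ k ∧ n = ((k + 1 : ℕ) : ℤ) :=
    ⟨(n - 1).toNat, by omega, by omega⟩
  choose k hk hn using ex
  have iso := isIso_homCohomologyToExt hK hP α hα
  -- The degree `n` equals the cast of `k + 1` only propositionally, hence the transports; `happ`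
  -- removes them when `n` is such a cast.
  let app (n : ℤ) (h : (m + 1 : ℤ) ≤ n) :
      (extCohomologicalFunctor A).T n ⟶ (homCohomologicalFunctor K hP).T n :=
    eqToHom (by rw [← hn n h]) ≫ inv (homCohomologyToExt hK hP α (k n h) (hk n h)) ≫
      eqToHom (by rw [← hn n h])
  have happ (j : ℕ) (hj : m ≤ j) (h) :
      app ((j + 1 : ℕ) : ℤ) h = inv (homCohomologyToExt hK hP α j hj) := by
    have e : k _ h = j := by have := hn _ h; omega
    have key : ∀ (j' : ℕ) (hj' : m ≤ j') (e : j' = j) (p q),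
        eqToHom p ≫ inv (homCohomologyToExt hK hP α j' hj') ≫ eqToHom q =
          inv (homCohomologyToExt hK hP α j hj) := by
      rintro _ _ rfl p q
      simp
    exact key _ _ e _ _
  refine ⟨⟨app, fun {S} hS n₀ n₁ h h₀ h₁ => ?_⟩, fun n h => ?_⟩
  · obtain ⟨j, hj, rfl⟩ : ∃ k : ℕ, m ≤ k ∧ n₀ = ((k + 1 : ℕ) : ℤ) := ⟨_, hk _ h₀, hn _ h₀⟩
    obtain rfl : n₁ = ((j + 2 : ℕ) : ℤ) := by omega
    have comm := homCohomologyToExt_comm hK hP α j hj hS h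
    rw [happ j hj, happ (j + 1) (by omega)]
    have i₀ := congrArg (fun t => t.app S.X₃) (IsIso.inv_hom_id (homCohomologyToExt hK hP α j hj))
    have i₁ := congrArg (fun t => t.app S.X₁)
      (IsIso.hom_inv_id (homCohomologyToExt hK hP α (j + 1) (by omega)))
    dsimp only [NatTrans.comp_app, NatTrans.id_app] at i₀ i₁
    have c := congrArg (fun t => (inv (homCohomologyToExt hK hP α j hj)).app S.X₃ ≫ t ≫
      (inv (homCohomologyToExt hK hP α (j + 1) (by omega))).app S.X₁) comm
    simp only [Category.assoc] at c
    rw [reassoc_of% i₀, i₁, Category.comp_id] at c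
    exact c.symm
  · obtain ⟨j, hj, rfl⟩ : ∃ k : ℕ, m ≤ k ∧ n = ((k + 1 : ℕ) : ℤ) := ⟨_, hk _ h, hn _ h⟩
    change IsIso (app _ h)
    rw [happ j hj]
    infer_instance

end

/-- Acyclicity of `Hom(K, Q)` for projective `Q` enters only here; the comparison in high degrees
does not need it. -/
theorem tateFarrellExt_vanishesOnProjectives (hK : IsCompleteResolution A K) :
    (tateFarrellExt hK).VanishesOnProjectives :=
  fun Q hQ n => (hK.hom_acyclic Q hQ n).isZero_homology

/-- The Tate–Farrell Ext-functors are a Mislin completion of the Ext-functors. -/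
theorem exists_isMislinCompletion_tateFarrellExt [EnoughProjectives C]
    (hK : IsCompleteResolution A K) :
    ∃ ν : extCohomologicalFunctor A ⟶ tateFarrellExt hK,
      CohomologicalFunctor.IsMislinCompletion ν := by
  obtain ⟨m, α, hα⟩ := hK.exists_isShiftClass
  obtain ⟨f, hf⟩ := exists_homFrom_isIso hK.acyclic hK.projective α hα
  have hU := tateFarrellExt_vanishesOnProjectives hK
  refine ⟨f.extend hU, CohomologicalFunctor.isMislinCompletion_of_isIso hU (m + 1) _ fun n h => ?_⟩
  rw [f.extend_app hU n h]
  exact hf n h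

end TateFarrell

theorem lemma3p6 {C : Type u} [Category.{v} C] [Abelian C] [EnoughProjectives C]
    (A : C) (K : ChainComplex C ℤ) (hK : IsCompleteResolution A K) :
    (∃ (E : CohomologicalFunctor C AddCommGrpCat.{v}) (ν : extCohomologicalFunctor A ⟶ E),
      CohomologicalFunctor.IsMislinCompletion ν) ∧
    ∀ (E : CohomologicalFunctor C AddCommGrpCat.{v}) (ν : extCohomologicalFunctor A ⟶ E),
      CohomologicalFunctor.IsMislinCompletion ν → Nonempty (tateFarrellExt hK ≅ E) := by
  obtain ⟨ν, hν⟩ := exists_isMislinCompletion_tateFarrellExt hK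
  exact ⟨⟨_, ν, hν⟩, fun _ _ h => hν.nonempty_iso h⟩
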